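/- **Setting.** For $N\ge 0$ and $p\in(0,1)$, let $\mathcal B_p$ be the distribution on $\{\pm1\}^N$ whose coordinates are independent and equal to $1$ with probability $p$ and to $-1$ with probability $1-p$. A point $x\in\{\pm1\}^N$ stands for a training subset. For $f:\{\pm1\}^N\to\mathbb R$ and $\mathbf a\in\mathbb R^N$ put $$\mathrm{mse}^{(p)}(f,\mathbf a)=\mathbb E_{x\sim\mathcal B_p}\big[(f(x)-\langle\mathbf a,x\rangle)^2\big],\qquad \Phi(f)\in\arg\min_{\mathbf a\in\mathbb R^N}\mathrm{mse}^{(p)}(f,\mathbf a),$$ $$\mathrm{err}(\mathbf a,\Phi(f))=\mathrm{mse}^{(p)}(f,\mathbf a)-\mathrm{mse}^{(p)}(f,\Phi(f)).$$ Let $f_1,\dots,f_Z:\{\pm1\}^N\to[-b,b]$ be the model output functions. A randomized verifier $\mathsf V$ exchanges messages in $\{0,1\}^*$ with a prover and finally outputs either $\mathrm{abort}$ or $Z$ vectors $\hat{\mathbf a}_1,\dots,\hat{\mathbf a}_Z\in\mathbb R^N$. $\mathsf V$ has access to the $f_z$ only through local trainings: one training on a subset $x$ of its choice gives it the values $f_1(x),\dots,f_Z(x)$.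 The honest prover $\mathsf P$ knows $f_1,\dots,f_Z$. A dishonest prover is arbitrary (randomized, computationally unbounded, and possibly dependent on $f_1,\dots,f_Z$); it sees the messages but not the private randomness of $\mathsf V$. The pair $(\mathsf V,\mathsf P)$ is a *simultaneous $(\varepsilon,\delta)$-PAC verifier with cost at most $\kappa$* for the range $[-b,b]$ if for all $f_1,\dots,f_Z:\{\pm1\}^N\to[-b,b]$: * (Completeness) when $\mathsf V$ interacts with $\mathsf P$, with probability at least $1-\delta$ the output is not $\mathrm{abort}$ and $\mathrm{err}(\hat{\mathbf a}_z,\Phi(f_z))\le\varepsilon$ for all $z$; * (Soundness) when $\mathsf V$ interacts with any prover $\mathsf P'$, with probability at most $\delta$ the output is not $\mathrm{abort}$ and $\mathrm{err}(\hat{\mathbf a}_z,\Phi(f_z))>\varepsilon$ for some $z$; * (Cost) with any prover, the expected number of local trainings of $\mathsf V$ is at most $\kappa$. **Theorem.** There is an absolute exponent $d\in\mathbb N$ such that for every $b\ge0$ there are a constant $C$, depending only on $b$, and a cost function $(Z,\varepsilon,\delta)\mapsto\kappa_Z(\varepsilon,\delta)\in\mathbb N$ with $$\kappa_Z(\varepsilon,\delta)\le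 C\cdot\frac1{\varepsilon^2}\cdot(1+\log Z)^d\cdot(1+\log(1/\delta))^d\qquad\text{for all }Z\ge1,\ \varepsilon,\delta\in(0,1),$$ such that for all $N\ge0$, $Z\ge1$, $p\in(0,1)$ and $\varepsilon,\delta\in(0,1)$ there is a simultaneous $(\varepsilon,\delta)$-PAC verifier with cost at most $\kappa_Z(\varepsilon,\delta)$ for the range $[-b,b]$, in which exactly two messages are exchanged in every execution (one from $\mathsf V$, then one from the prover). In particular the cost does not depend on $N$. -/

import Mathlib

open Finset

/-! ## Model output functions, mean squared error, optimal attribution -/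

/-- The cube `{±1}^N`: the point `x` stands for the training subset `{i | x i = 1}`. -/
abbrev Cube (N : ℕ) : Type := Fin N → ℤˣ

/-- The probability of `x` under the `p`-biased distribution `B_p` on `{±1}^N`: the coordinates are
independent, each equal to `1` with probability `p` and to `-1` with probability `1 - p`. -/
def biasedWeight {N : ℕ} (p : ℝ) (x : Cube N) : ℝ :=
  ∏ i, if x i = 1 then p else 1 - p

/-- The linear predictor `⟨a, x⟩`. -/
def linearPredictor {N : ℕ} (a : Fin N → ℝ) (x : Cube N) : ℝ :=
  ∑ i, a i * ((x i : ℤ) : ℝ)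

/-- `mse^{(p)}(f, ⟨a, ·⟩) = E_{x ∼ B_p} (f x - ⟨a, x⟩)²`. -/
def mse {N : ℕ} (p : ℝ) (f : Cube N → ℝ) (a : Fin N → ℝ) : ℝ :=
  ∑ x, biasedWeight p x * (f x - linearPredictor a x) ^ 2

/-- `a` minimizes the mean squared error among all linear predictors. -/
def IsOptimalAttribution {N : ℕ} (p : ℝ) (f : Cube N → ℝ) (a : Fin N → ℝ) : Prop :=
  ∀ a' : Fin N → ℝ, mse p f a ≤ mse p f a'

/-- A minimizer of the mean squared error exists. -/
theorem exists_isOptimalAttribution {N : ℕ} {p : ℝ} (hp0 : 0 ≤ p) (hp1 : p ≤ 1)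
    (f : Cube N → ℝ) : ∃ a, IsOptimalAttribution p f a := by
  have hw : ∀ x : Cube N, 0 ≤ biasedWeight p x := fun x =>
    Finset.prod_nonneg fun i _ => by split_ifs <;> linarith
  let L : (Fin N → ℝ) →ₗ[ℝ] EuclideanSpace ℝ (Cube N) :=
    { toFun := fun a => WithLp.toLp 2 fun x => √(biasedWeight p x) * linearPredictor a x
      map_add' := fun a a' => by
        ext x
        simp [linearPredictor, add_mul, Finset.sum_add_distrib, mul_add]
      map_smul' := fun c a => by
        ext x
        simp only [linearPredictor, Pi.smul_apply, smul_eq_mul, RingHom.id_apply,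
          PiLp.smul_apply, mul_assoc]
        rw [← Finset.mul_sum]
        ring }
  let u : EuclideanSpace ℝ (Cube N) := WithLp.toLp 2 fun x => √(biasedWeight p x) * f x
  have key : ∀ a, mse p f a = ‖u - L a‖ ^ 2 := by
    intro a
    rw [EuclideanSpace.real_norm_sq_eq]
    refine Finset.sum_congr rfl fun x _ => ?_
    change _ = (√(biasedWeight p x) * f x - √(biasedWeight p x) * linearPredictor a x) ^ 2
    rw [← mul_sub, mul_pow, Real.sq_sqrt (hw x)]
  obtain ⟨v, hv, hmin⟩ := Submodule.exists_norm_eq_iInf_of_complete_subspace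
    (LinearMap.range L) (LinearMap.range L).complete_of_finiteDimensional u
  obtain ⟨a, rfl⟩ := hv
  refine ⟨a, fun a' => ?_⟩
  rw [key, key, hmin]
  refine pow_le_pow_left₀ (Real.iInf_nonneg fun _ => norm_nonneg _) ?_ 2
  exact ciInf_le ⟨0, by rintro _ ⟨_, rfl⟩; exact norm_nonneg _⟩
    (⟨L a', LinearMap.mem_range_self L a'⟩ : LinearMap.range L)

open Classical in
/-- `Φ = argmin_a mse^{(p)}(f, ⟨a, ·⟩)`, the optimal attribution vector. -/
noncomputable def optimalAttribution {N : ℕ} (p : ℝ) (f : Cube N → ℝ) : Fin N → ℝ :=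
  if h : ∃ a, IsOptimalAttribution p f a then h.choose else 0

/-- The definition of `Φ` never takes its default value when `p` is a probability. -/
theorem isOptimalAttribution_optimalAttribution {N : ℕ} {p : ℝ} (hp0 : 0 ≤ p) (hp1 : p ≤ 1)
    (f : Cube N → ℝ) : IsOptimalAttribution p f (optimalAttribution p f) := by
  have h := exists_isOptimalAttribution hp0 hp1 f
  rw [optimalAttribution, dif_pos h]
  exact h.choose_spec

/-- `err(a, Φ) = mse^{(p)}(f, ⟨a, ·⟩) - mse^{(p)}(f, ⟨Φ, ·⟩)`. -/
noncomputable def attributionErr {N : ℕ} (p : ℝ) (f : Cube N → ℝ) (a : Fin N → ℝ) : ℝ :=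
  mse p f a - mse p f (optimalAttribution p f)

/-! ## Interactive proof systems -/

/-- Messages are bit strings. -/
abbrev Message : Type := List Bool

/-- `Z` model output functions `f_1, …, f_Z : {±1}^N → ℝ`. -/
abbrev ModelOutputs (N Z : ℕ) : Type := Fin Z → Cube N → ℝ

/-- The strategy of a randomized verifier that has to output `Z` attribution vectors, or to abort.
At each step it may
* halt, with the output `none` (abort) or `some a`;
* draw a private random number from a distribution of its choice;
* locally train a model on a subset `x` of its choice and evaluate all `Z` model output functions
  on that model;
* send a message and wait for the reply of the prover. -/
inductive Verifier (N Z : ℕ) : Type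
  | halt (output : Option (Fin Z → Fin N → ℝ)) : Verifier N Z
  | draw (μ : PMF ℕ) (next : ℕ → Verifier N Z) : Verifier N Z
  | train (x : Cube N) (next : (Fin Z → ℝ) → Verifier N Z) : Verifier N Z
  | send (w : Message) (next : Message → Verifier N Z) : Verifier N Z

/-- The strategy of a (computationally unbounded, possibly randomized) prover: the distribution of
its next message, given the messages exchanged so far, in both directions and in order. -/
abbrev Prover : Type := List Message → PMF Message

/-- What is recorded about an execution: the output of the verifier (`none` is abort), the number
of models that the verifier has trained, and all messages exchanged. -/
structure Outcome (N Z : ℕ) : Type where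
  output : Option (Fin Z → Fin N → ℝ)
  trainings : ℕ
  transcript : List Message

/-- The distribution of the outcome of an execution that continues with the given verifier strategy
after `c` trainings and the messages `t`. -/
noncomputable def Verifier.runFrom {N Z : ℕ} (f : ModelOutputs N Z) (P : Prover) :
    Verifier N Z → ℕ → List Message → PMF (Outcome N Z)
  | .halt output, c, t => PMF.pure ⟨output, c, t⟩
  | .draw μ next, c, t => μ.bind fun n => runFrom f P (next n) c t
  | .train x next, c, t => runFrom f P (next fun z => f z x) (c + 1) t
  | .send w next, c, t => (P (t ++ [w])).bind fun r => runFrom f P (next r) c (t ++ [w, r])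

/-- The distribution of the outcome when `V` interacts with `P`, where `f` are the model output
functions. -/
noncomputable def Verifier.run {N Z : ℕ} (V : Verifier N Z) (f : ModelOutputs N Z) (P : Prover) :
    PMF (Outcome N Z) :=
  V.runFrom f P 0 []

/-- The expected number of trainings that `V` conducts when it interacts with `P`. -/
noncomputable def Verifier.expectedTrainings {N Z : ℕ} (V : Verifier N Z) (f : ModelOutputs N Z)
    (P : Prover) : ENNReal :=
  ∑' o, V.run f P o * (o.trainings : ENNReal)

/-- A verifier together with an honest prover. The honest prover knows the model output functions;
the verifier has access to them only through trainings. -/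
structure InteractiveProofSystem (N Z : ℕ) : Type where
  verifier : Verifier N Z
  honestProver : ModelOutputs N Z → Prover

/-- `(V, P)` is an `(ε, δ)`-PAC verifier of cost at most `κ` for the optimal attribution vectors
(with respect to `B_p`) of `Z` model output functions with values in `[-b, b]`. -/
structure InteractiveProofSystem.IsPACVerifier {N Z : ℕ} (S : InteractiveProofSystem N Z)
    (b p ε δ : ℝ) (κ : ℕ) : Prop where
  /-- With the honest prover, all `Z` vectors are accepted and `ε`-close to optimal, with
  probability at least `1 - δ`. -/
  completeness : ∀ f : ModelOutputs N Z, (∀ z x, f z x ∈ Set.Icc (-b) b) →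
    ENNReal.ofReal (1 - δ) ≤ (S.verifier.run f (S.honestProver f)).toOuterMeasure
      {o | ∃ a, o.output = some a ∧ ∀ z, attributionErr p (f z) (a z) ≤ ε}
  /-- With any prover, the probability that vectors are accepted of which at least one is not
  `ε`-close to optimal is at most `δ`. -/
  soundness : ∀ f : ModelOutputs N Z, (∀ z x, f z x ∈ Set.Icc (-b) b) → ∀ P' : Prover,
    (S.verifier.run f P').toOuterMeasure
      {o | ∃ a, o.output = some a ∧ ∃ z, ε < attributionErr p (f z) (a z)} ≤ ENNReal.ofReal δ
  /-- With any prover, honest or not, the expected number of local trainings is at most `κ`. -/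
  cost : ∀ f : ModelOutputs N Z, (∀ z x, f z x ∈ Set.Icc (-b) b) → ∀ P' : Prover,
    S.verifier.expectedTrainings f P' ≤ (κ : ENNReal)

/-- In every possible execution, with any prover, exactly `m` messages are exchanged. -/
def InteractiveProofSystem.ExchangesMessages {N Z : ℕ} (S : InteractiveProofSystem N Z)
    (m : ℕ) : Prop :=
  ∀ (f : ModelOutputs N Z) (P' : Prover), ∀ o ∈ (S.verifier.run f P').support,
    o.transcript.length = m

/-! ## The biased distribution -/

/-! The length of messages is unrestricted, so the honest prover can send a complete table `g` of
all model outputs, rounded to a grid. The verifier compares the table with fresh trainings at random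
points of `B_p` and, if nothing contradicts it, outputs the optimal attributions of `g`.

Two facts make this sound. Least squares is an orthogonal projection in `L²(B_p)`, hence a
contraction, so the error of the output is at most `‖f - g‖²`
(`attributionErr_optimalAttribution_le`). Since `f` and `g` are bounded by `b`, an `L²` distance
above `√ε` forces a disagreement beyond the tolerance with probability of order `ε / b²`
(`agreement_le_of_lt_attributionErr`). The table is fixed before the points are drawn, so
independent checks reject a bad one except with probability `(1 - ε / (8 b² + 1)) ^ m`, and `m` of
order `(b² + 1) / ε * log (1 / δ)` suffices.

One training tests all `Z` functions, and a single bad index already causes rejection: no union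
bound is needed and the cost depends on neither `Z` nor `N`. -/

theorem biasedWeight_nonneg {N : ℕ} {p : ℝ} (hp0 : 0 ≤ p) (hp1 : p ≤ 1) (x : Cube N) :
    0 ≤ biasedWeight p x :=
  Finset.prod_nonneg fun i _ => by split_ifs <;> linarith

theorem sum_biasedWeight {N : ℕ} (p : ℝ) : ∑ x : Cube N, biasedWeight p x = 1 := by
  have h := Finset.prod_univ_sum (fun _ : Fin N => (Finset.univ : Finset ℤˣ))
    (fun _ u => if u = 1 then p else 1 - p)
  rw [Fintype.piFinset_univ] at h
  unfold biasedWeight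
  rw [← h]
  have h1 : ∑ u : ℤˣ, (if u = 1 then p else 1 - p) = 1 := by
    have hne : (-1 : ℤˣ) ≠ 1 := by decide
    rw [UnitsInt.univ, Finset.sum_pair hne.symm, if_pos rfl, if_neg hne]
    ring
  simp only [h1, Finset.prod_const_one]

/-- The distribution `B_p` on the cube. -/
noncomputable def biasedPMF {N : ℕ} (p : ℝ) (hp0 : 0 ≤ p) (hp1 : p ≤ 1) : PMF (Cube N) :=
  PMF.ofFintype (fun x => ENNReal.ofReal (biasedWeight p x)) <| by
    rw [← ENNReal.ofReal_sum_of_nonneg fun x _ => biasedWeight_nonneg hp0 hp1 x,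
      sum_biasedWeight, ENNReal.ofReal_one]

open Classical in
theorem biasedPMF_toOuterMeasure {N : ℕ} {p : ℝ} (hp0 : 0 ≤ p) (hp1 : p ≤ 1)
    (s : Set (Cube N)) :
    (biasedPMF p hp0 hp1).toOuterMeasure s
      = ENNReal.ofReal (∑ x, if x ∈ s then biasedWeight p x else 0) := by
  rw [PMF.toOuterMeasure_apply, tsum_fintype, ENNReal.ofReal_sum_of_nonneg fun x _ => by
    split_ifs
    exacts [biasedWeight_nonneg hp0 hp1 x, le_rfl]]
  refine Finset.sum_congr rfl fun x _ => ?_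
  by_cases hx : x ∈ s <;> simp [hx, biasedPMF]

/-! ## Stability of optimal attribution vectors -/

theorem linearPredictor_add_smul_sub {N : ℕ} (a a' : Fin N → ℝ) (t : ℝ) (x : Cube N) :
    linearPredictor (a + t • (a' - a)) x
      = linearPredictor a x + t * (linearPredictor a' x - linearPredictor a x) := by
  simp only [linearPredictor, ← Finset.sum_sub_distrib, Finset.mul_sum, ← Finset.sum_add_distrib]
  refine Finset.sum_congr rfl fun i _ => ?_
  simp only [Pi.add_apply, Pi.smul_apply, Pi.sub_apply, smul_eq_mul]
  ring

/-- The residual of a minimizer is orthogonal to all linear predictors. -/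
theorem IsOptimalAttribution.orthogonal {N : ℕ} {p : ℝ} {f : Cube N → ℝ} {a : Fin N → ℝ}
    (h : IsOptimalAttribution p f a) (a' : Fin N → ℝ) :
    ∑ x, biasedWeight p x * ((f x - linearPredictor a x)
      * (linearPredictor a' x - linearPredictor a x)) = 0 := by
  set I := ∑ x, biasedWeight p x * ((f x - linearPredictor a x)
    * (linearPredictor a' x - linearPredictor a x)) with hI
  set Q := ∑ x, biasedWeight p x * (linearPredictor a' x - linearPredictor a x) ^ 2 with hQ
  -- Moving from `a` towards `a'` by `t` changes the error by a quadratic in `t` without constant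
  -- term. It is nonnegative, so its discriminant `4 * I ^ 2` is at most `0`.
  have key : ∀ t : ℝ, 0 ≤ Q * (t * t) + (-2 * I) * t + 0 := by
    intro t
    have h1 : mse p f (a + t • (a' - a)) = mse p f a + (Q * (t * t) + (-2 * I) * t) := by
      simp only [mse, hI, hQ, linearPredictor_add_smul_sub, Finset.sum_mul, Finset.mul_sum,
        ← Finset.sum_add_distrib]
      exact Finset.sum_congr rfl fun x _ => by ring
    linarith [h (a + t • (a' - a))]
  have := discrim_le_zero key
  rw [discrim] at this
  nlinarith

/-- The optimal attribution of `g` is nearly optimal for `f` if `f` and `g` are close in `L²`. -/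
theorem attributionErr_optimalAttribution_le {N : ℕ} {p : ℝ} (hp0 : 0 ≤ p) (hp1 : p ≤ 1)
    (f g : Cube N → ℝ) :
    attributionErr p f (optimalAttribution p g)
      ≤ ∑ x, biasedWeight p x * (f x - g x) ^ 2 := by
  set u := optimalAttribution p g
  set v := optimalAttribution p f
  have hg := (isOptimalAttribution_optimalAttribution hp0 hp1 g).orthogonal v
  have hf := (isOptimalAttribution_optimalAttribution hp0 hp1 f).orthogonal u
  -- Pythagoras: the residual of `f` at `v` is orthogonal to the difference of the two predictors.
  have h1 : attributionErr p f u = ∑ x, biasedWeight p x *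
      ((linearPredictor u x - linearPredictor v x) ^ 2) := by
    rw [← sub_eq_zero, ← mul_eq_zero_of_right (-2 : ℝ) hf]
    simp only [attributionErr, mse, Finset.mul_sum, ← Finset.sum_sub_distrib]
    exact Finset.sum_congr rfl fun x _ => by ring
  have h2 : (2 : ℝ) * ∑ x, biasedWeight p x *
      ((linearPredictor u x - linearPredictor v x) ^ 2)
      ≤ (∑ x, biasedWeight p x * (f x - g x) ^ 2) + ∑ x, biasedWeight p x *
      ((linearPredictor u x - linearPredictor v x) ^ 2) := by
    -- Subtracting the two orthogonality relations identifies the difference of the predictors with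
    -- the projection of `f - g`; then `2xy ≤ x² + y²` gives the contraction.
    have e : (2 : ℝ) * ∑ x, biasedWeight p x *
        ((linearPredictor u x - linearPredictor v x) ^ 2)
        = ∑ x, biasedWeight p x *
          (2 * (f x - g x) * (linearPredictor v x - linearPredictor u x)) := by
      rw [← sub_eq_zero]
      have : (2 : ℝ) * (-(∑ x, biasedWeight p x * ((g x - linearPredictor u x)
          * (linearPredictor v x - linearPredictor u x)))
          - ∑ x, biasedWeight p x * ((f x - linearPredictor v x)
          * (linearPredictor u x - linearPredictor v x))) = 0 := by
        rw [hf, hg]; ring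
      rw [← neg_eq_zero, ← this]
      simp only [Finset.mul_sum, ← Finset.sum_sub_distrib, ← Finset.sum_neg_distrib]
      exact Finset.sum_congr rfl fun x _ => by ring
    rw [e, ← Finset.sum_add_distrib]
    refine Finset.sum_le_sum fun x _ => ?_
    rw [← mul_add]
    refine mul_le_mul_of_nonneg_left ?_ (biasedWeight_nonneg hp0 hp1 x)
    nlinarith [sq_nonneg ((f x - g x) - (linearPredictor v x - linearPredictor u x))]
  linarith

open Classical in
/-- If two functions with values in `[-b, b]` are far apart in `L²`, then they visibly disagree
with a probability of order `ε`. -/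
theorem agreement_le_of_lt_attributionErr {N : ℕ} {b p ε : ℝ} (hp0 : 0 ≤ p) (hp1 : p ≤ 1)
    (hε : 0 ≤ ε) {f g : Cube N → ℝ} (hf : ∀ x, f x ∈ Set.Icc (-b) b)
    (hg : ∀ x, g x ∈ Set.Icc (-b) b) (h : ε < attributionErr p f (optimalAttribution p g)) :
    (∑ x, if |f x - g x| ≤ √(ε / 2) then biasedWeight p x else 0)
      ≤ 1 - ε / (8 * b ^ 2 + 1) := by
  set A := ∑ x, if |f x - g x| ≤ √(ε / 2) then biasedWeight p x else 0 with hA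
  have hA1 : A ≤ 1 := by
    rw [← sum_biasedWeight (N := N) p]
    refine Finset.sum_le_sum fun x _ => ?_
    split_ifs
    exacts [le_rfl, biasedWeight_nonneg hp0 hp1 x]
  -- Points of agreement contribute at most `ε / 2`, all others at most `(2b)²` each, weighted by
  -- their probability.
  have h1 : ∑ x, biasedWeight p x * (f x - g x) ^ 2 ≤ ε / 2 + 4 * b ^ 2 * (1 - A) := by
    have e : ε / 2 + 4 * b ^ 2 * (1 - A) = ∑ x, (biasedWeight p x * (ε / 2)
        + 4 * b ^ 2 * (biasedWeight p x
          - if |f x - g x| ≤ √(ε / 2) then biasedWeight p x else 0)) := by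
      rw [Finset.sum_add_distrib, ← Finset.sum_mul, ← Finset.mul_sum, Finset.sum_sub_distrib,
        sum_biasedWeight, one_mul]
    rw [e]
    refine Finset.sum_le_sum fun x _ => ?_
    have hw := biasedWeight_nonneg hp0 hp1 x
    split_ifs with hx
    · have h2 : (f x - g x) ^ 2 ≤ ε / 2 := by
        rw [← sq_abs, ← Real.sq_sqrt (by positivity : 0 ≤ ε / 2)]
        exact pow_le_pow_left₀ (abs_nonneg _) hx 2
      rw [sub_self, mul_zero, add_zero]
      exact mul_le_mul_of_nonneg_left h2 hw
    · obtain ⟨hf1, hf2⟩ := hf x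
      obtain ⟨hg1, hg2⟩ := hg x
      have h2 : (f x - g x) ^ 2 ≤ 4 * b ^ 2 := by nlinarith
      have h3 := mul_le_mul_of_nonneg_left h2 hw
      have h4 : 0 ≤ biasedWeight p x * (ε / 2) := by positivity
      linarith
  have h2 := attributionErr_optimalAttribution_le hp0 hp1 f g
  -- The `+ 1` covers `b = 0` and will also make the quotient at most `1`.
  have h3 : ε / (8 * b ^ 2 + 1) ≤ 1 - A := by
    rw [div_le_iff₀ (by positivity)]
    nlinarith
  linarith

/-! ## Spot checks -/

noncomputable instance {N : ℕ} : Encodable (Cube N) := Encodable.ofCountable _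

/-- Draw `m` independent points from `μ`, train a model on each, and output `out` unless the
predicate `ok` fails at one of them. -/
noncomputable def spotCheck {N Z : ℕ} (μ : PMF (Cube N)) (ok : Cube N → (Fin Z → ℝ) → Prop)
    (out : Fin Z → Fin N → ℝ) : ℕ → Verifier N Z
  | 0 => .halt (some out)
  | m + 1 => .draw (μ.map Encodable.encode) fun n =>
      -- The default `1` is never used, because only codes of points are drawn.
      let x : Cube N := (Encodable.decode n).getD 1
      .train x fun v => open Classical in if ok x v then spotCheck μ ok out m else .halt none

section SpotCheck

variable {N Z : ℕ} (f : ModelOutputs N Z) (P : Prover) (μ : PMF (Cube N))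
  (ok : Cube N → (Fin Z → ℝ) → Prop) (out : Fin Z → Fin N → ℝ)

open Classical in
theorem runFrom_spotCheck_succ (m c : ℕ) (t : List Message) :
    (spotCheck μ ok out (m + 1)).runFrom f P c t = μ.bind fun x =>
      if ok x (fun z => f z x) then (spotCheck μ ok out m).runFrom f P (c + 1) t
      else PMF.pure ⟨none, c + 1, t⟩ := by
  rw [spotCheck, Verifier.runFrom, PMF.bind_map]
  congr 1
  funext x
  simp only [Function.comp, Encodable.encodek, Option.getD_some, Verifier.runFrom]
  split_ifs
  · rfl
  · rw [Verifier.runFrom]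

theorem spotCheck_support (m c : ℕ) (t : List Message) :
    ∀ o ∈ ((spotCheck μ ok out m).runFrom f P c t).support,
      (∀ a, o.output = some a → a = out) ∧ o.trainings ≤ c + m ∧ o.transcript = t := by
  classical
  induction m generalizing c with
  | zero =>
    intro o ho
    rw [spotCheck, Verifier.runFrom, PMF.support_pure, Set.mem_singleton_iff] at ho
    subst ho
    simp
  | succ m ih =>
    intro o ho
    rw [runFrom_spotCheck_succ, PMF.mem_support_bind_iff] at ho
    obtain ⟨x, -, ho⟩ := ho
    split_ifs at ho
    · obtain ⟨h1, h2, h3⟩ := ih _ o ho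
      exact ⟨h1, by omega, h3⟩
    · rw [PMF.support_pure, Set.mem_singleton_iff] at ho
      subst ho
      simp

/-- The draws are independent and one failure aborts, so the passing probabilities multiply. -/
theorem spotCheck_accept (m c : ℕ) (t : List Message) :
    ((spotCheck μ ok out m).runFrom f P c t).toOuterMeasure {o | ∃ a, o.output = some a}
      = μ.toOuterMeasure {x | ok x fun z => f z x} ^ m := by
  classical
  induction m generalizing c with
  | zero => simp [spotCheck, Verifier.runFrom, PMF.toOuterMeasure_pure_apply]
  | succ m ih =>
    rw [runFrom_spotCheck_succ, PMF.toOuterMeasure_bind_apply, pow_succ', PMF.toOuterMeasure_apply,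
      ← ENNReal.tsum_mul_right]
    refine tsum_congr fun x => ?_
    by_cases hx : ok x fun z => f z x
    · simp [hx, ih]
    · simp [hx, PMF.toOuterMeasure_pure_apply]

theorem runFrom_spotCheck_of_forall (h : ∀ x, ok x fun z => f z x) (m c : ℕ) (t : List Message) :
    (spotCheck μ ok out m).runFrom f P c t = PMF.pure ⟨some out, c + m, t⟩ := by
  induction m generalizing c with
  | zero => rw [spotCheck, Verifier.runFrom, add_zero]
  | succ m ih =>
    rw [runFrom_spotCheck_succ]
    simp only [h, if_true, ih]
    rw [PMF.bind_const, add_right_comm, add_assoc]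

end SpotCheck

/-! ## The proof system -/

noncomputable instance {N Z : ℕ} : Encodable (Fin Z → Cube N → ℤ) := Encodable.ofCountable _

/-- A decoding of bit strings. -/
def decodeMessage (α : Type*) [Encodable α] [Inhabited α] (w : Message) : α :=
  -- Invalid codes get the default value, so any reply of a dishonest prover counts as a table.
  (Encodable.decode (Nat.ofDigits 2 (w.map fun c => cond c 1 0))).getD default

/-- The encoding in bit strings by binary expansions. -/
def encodeMessage {α : Type*} [Encodable α] (a : α) : Message :=
  (Encodable.encode a).bits

theorem decodeMessage_encodeMessage {α : Type*} [Encodable α] [Inhabited α] (a : α) :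
    decodeMessage α (encodeMessage a) = a := by
  rw [decodeMessage, encodeMessage, ← Nat.digits_two_eq_bits, Nat.ofDigits_digits,
    Encodable.encodek, Option.getD_some]

/-- The model outputs in `[-b, b]` that a table of multiples of `η` describes. -/
noncomputable def tableOutputs {N Z : ℕ} (b η : ℝ) (k : Fin Z → Cube N → ℤ) :
    ModelOutputs N Z :=
  -- Clamping enforces the bound needed for soundness, whatever integers the prover sends.
  fun z x => max (-b) (min b (η * k z x))

theorem tableOutputs_mem {N Z : ℕ} {b : ℝ} (hb : 0 ≤ b) (η : ℝ) (k : Fin Z → Cube N → ℤ)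
    (z : Fin Z) (x : Cube N) : tableOutputs b η k z x ∈ Set.Icc (-b) b :=
  ⟨le_max_left _ _, max_le (by linarith) (min_le_left _ _)⟩

/-- Rounding moves a value by at most `η / 2`, and clamping to an interval that contains `f z x`
keeps it within `η`. -/
theorem abs_sub_tableOutputs_round_le {N Z : ℕ} {b η : ℝ} (hη : 0 < η) {f : ModelOutputs N Z}
    (hf : ∀ z x, f z x ∈ Set.Icc (-b) b) (z : Fin Z) (x : Cube N) :
    |f z x - tableOutputs b η (fun z x => round (f z x / η)) z x| ≤ η := by
  have h1 : |f z x - η * round (f z x / η)| ≤ η := by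
    have h2 := abs_sub_round (f z x / η)
    have h3 : f z x - η * round (f z x / η) = η * (f z x / η - round (f z x / η)) := by
      field_simp
    rw [h3, abs_mul, abs_of_pos hη]
    nlinarith
  obtain ⟨hf1, hf2⟩ := hf z x
  obtain ⟨h4, h5⟩ := abs_le.mp h1
  rw [tableOutputs, abs_le]
  constructor
  · rw [neg_le_sub_iff_le_add]
    exact max_le (by linarith) ((min_le_right _ _).trans (by linarith))
  · rw [sub_le_comm]
    exact (le_min (by linarith) (by linarith)).trans (le_max_right _ _)

/-- The prover sends the table of all model outputs, rounded to multiples of `√(ε / 2)`. The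
verifier spot-checks it at `m` random points and outputs the optimal attributions of the table. -/
noncomputable def tableProofSystem (N Z : ℕ) (b p ε : ℝ) (hp0 : 0 ≤ p) (hp1 : p ≤ 1) (m : ℕ) :
    InteractiveProofSystem N Z where
  verifier := .send [] fun r =>
    let g := tableOutputs b √(ε / 2) (decodeMessage (Fin Z → Cube N → ℤ) r)
    spotCheck (biasedPMF p hp0 hp1) (fun x v => ∀ z, |v z - g z x| ≤ √(ε / 2))
      (fun z => optimalAttribution p (g z)) m
  honestProver f _ := PMF.pure (encodeMessage fun z x => round (f z x / √(ε / 2)))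

section TableProofSystem

variable {N Z : ℕ} {b p ε : ℝ} (hp0 : 0 ≤ p) (hp1 : p ≤ 1) (m : ℕ)

theorem run_tableProofSystem (f : ModelOutputs N Z) (P : Prover) :
    (tableProofSystem N Z b p ε hp0 hp1 m).verifier.run f P = (P [[]]).bind fun r =>
      (spotCheck (biasedPMF p hp0 hp1)
        (fun x v => ∀ z, |v z - tableOutputs b √(ε / 2)
          (decodeMessage (Fin Z → Cube N → ℤ) r) z x| ≤ √(ε / 2))
        (fun z => optimalAttribution p (tableOutputs b √(ε / 2)
          (decodeMessage (Fin Z → Cube N → ℤ) r) z)) m).runFrom f P 0 [[], r] := by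
  rw [Verifier.run, tableProofSystem, Verifier.runFrom]
  rfl

theorem tableProofSystem_support (f : ModelOutputs N Z) (P : Prover) :
    ∀ o ∈ ((tableProofSystem N Z b p ε hp0 hp1 m).verifier.run f P).support,
      o.trainings ≤ m ∧ o.transcript.length = 2 := by
  intro o ho
  rw [run_tableProofSystem, PMF.mem_support_bind_iff] at ho
  obtain ⟨r, -, ho⟩ := ho
  obtain ⟨-, h2, h3⟩ := spotCheck_support _ _ _ _ _ _ _ _ o ho
  exact ⟨by omega, by rw [h3]; rfl⟩

theorem tableProofSystem_expectedTrainings_le (f : ModelOutputs N Z) (P : Prover) :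
    (tableProofSystem N Z b p ε hp0 hp1 m).verifier.expectedTrainings f P ≤ m := by
  rw [Verifier.expectedTrainings]
  set D := (tableProofSystem N Z b p ε hp0 hp1 m).verifier.run f P with hD
  calc ∑' o, D o * (o.trainings : ENNReal) ≤ ∑' o, D o * (m : ENNReal) := by
        refine ENNReal.tsum_le_tsum fun o => ?_
        by_cases ho : o ∈ D.support
        · have := (tableProofSystem_support hp0 hp1 m f P o ho).1
          gcongr
        · rw [PMF.apply_eq_zero_iff D o |>.mpr ho, zero_mul, zero_mul]
    _ = m := by rw [ENNReal.tsum_mul_right, PMF.tsum_coe, one_mul]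

/-- The grid step equals the tolerance of the checks, so the honest table always passes, and its
squared `L²` distance from `f` is at most `ε / 2`. -/
theorem tableProofSystem_complete (hε : 0 < ε) (f : ModelOutputs N Z)
    (hf : ∀ z x, f z x ∈ Set.Icc (-b) b) :
    ((tableProofSystem N Z b p ε hp0 hp1 m).verifier.run f
      ((tableProofSystem N Z b p ε hp0 hp1 m).honestProver f)).toOuterMeasure
      {o | ∃ a, o.output = some a ∧ ∀ z, attributionErr p (f z) (a z) ≤ ε} = 1 := by
  have hη : 0 < √(ε / 2) := Real.sqrt_pos.mpr (by positivity)
  have hclose := abs_sub_tableOutputs_round_le hη hf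
  rw [run_tableProofSystem]
  nth_rewrite 1 [tableProofSystem]
  rw [PMF.pure_bind]
  simp only [decodeMessage_encodeMessage]
  rw [runFrom_spotCheck_of_forall _ _ _ _ _ fun x z => hclose z x,
    PMF.toOuterMeasure_pure_apply, if_pos]
  refine ⟨_, rfl, fun z => (attributionErr_optimalAttribution_le hp0 hp1 _ _).trans ?_⟩
  calc _ ≤ ∑ x : Cube N, biasedWeight p x * (ε / 2) := by
        refine Finset.sum_le_sum fun x _ =>
          mul_le_mul_of_nonneg_left ?_ (biasedWeight_nonneg hp0 hp1 x)
        rw [← sq_abs]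
        exact (pow_le_pow_left₀ (abs_nonneg _) (hclose z x) 2).trans_eq
          (Real.sq_sqrt (by positivity))
    _ ≤ ε := by
        rw [← Finset.sum_mul, sum_biasedWeight]
        linarith

theorem tableProofSystem_sound (hb : 0 ≤ b) (hε : ε ∈ Set.Ioo (0 : ℝ) 1) (f : ModelOutputs N Z)
    (hf : ∀ z x, f z x ∈ Set.Icc (-b) b) (P : Prover) :
    ((tableProofSystem N Z b p ε hp0 hp1 m).verifier.run f P).toOuterMeasure
      {o | ∃ a, o.output = some a ∧ ∃ z, ε < attributionErr p (f z) (a z)}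
      ≤ ENNReal.ofReal ((1 - ε / (8 * b ^ 2 + 1)) ^ m) := by
  classical
  obtain ⟨hε0, hε1⟩ := hε
  have hq : 0 ≤ 1 - ε / (8 * b ^ 2 + 1) := by
    rw [sub_nonneg, div_le_one (by positivity)]
    nlinarith [sq_nonneg b]
  rw [run_tableProofSystem, PMF.toOuterMeasure_bind_apply]
  set B := ENNReal.ofReal ((1 - ε / (8 * b ^ 2 + 1)) ^ m) with hB
  -- A randomized reply is a mixture of fixed replies, so a bound for each fixed table suffices.
  suffices h : ∀ r, _ ≤ B from
    (ENNReal.tsum_le_tsum fun r => mul_le_mul_right (h r) _).trans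
      (by rw [ENNReal.tsum_mul_right, PMF.tsum_coe, one_mul])
  intro r
  set g := tableOutputs b √(ε / 2) (decodeMessage (Fin Z → Cube N → ℤ) r) with hg
  by_cases hz : ∃ z, ε < attributionErr p (f z) (optimalAttribution p (g z))
  · obtain ⟨z, hz⟩ := hz
    refine (PMF.toOuterMeasure_mono _ (t := {o | ∃ a, o.output = some a})
      fun o ho => ⟨_, ho.1.choose_spec.1⟩).trans ?_
    rw [spotCheck_accept, hB, ENNReal.ofReal_pow hq]
    refine pow_le_pow_left₀ zero_le ?_ m
    -- Passing a check requires agreement at the one bad index `z`; the other indices can be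
    -- ignored.
    refine (PMF.toOuterMeasure_mono _ (t := {x | |f z x - g z x| ≤ √(ε / 2)})
      fun x hx => (show ∀ z, |f z x - g z x| ≤ √(ε / 2) from hx.1) z).trans ?_
    rw [biasedPMF_toOuterMeasure]
    exact ENNReal.ofReal_le_ofReal (agreement_le_of_lt_attributionErr hp0 hp1 hε0.le (hf z)
      (tableOutputs_mem hb _ _ z) hz)
  -- If every vector computed from the table is good, acceptance does no harm: nothing else can be
  -- output.
  · refine (PMF.toOuterMeasure_mono _ (t := ∅) fun o ho => hz ?_).trans ?_
    · obtain ⟨⟨a, ha, z, h⟩, ho⟩ := ho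
      obtain rfl := (spotCheck_support _ _ _ _ _ _ _ _ o ho).1 a ha
      exact ⟨z, h⟩
    · simp

end TableProofSystem

/-- The number of spot checks that rejects a bad table with probability at least `1 - δ`. -/
noncomputable def spotCheckCount (b ε δ : ℝ) : ℕ :=
  ⌈(8 * b ^ 2 + 1) / ε * Real.log (1 / δ)⌉₊

/-- By `1 - t ≤ exp (-t)`, the count makes the exponent at most `-log (1 / δ)`. -/
theorem pow_spotCheckCount_le {b ε δ : ℝ} (hε : ε ∈ Set.Ioo (0 : ℝ) 1)
    (hδ : δ ∈ Set.Ioo (0 : ℝ) 1) :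
    (1 - ε / (8 * b ^ 2 + 1)) ^ spotCheckCount b ε δ ≤ δ := by
  obtain ⟨hε0, hε1⟩ := hε
  have hq0 : 0 < ε / (8 * b ^ 2 + 1) := by positivity
  have hq : 0 ≤ 1 - ε / (8 * b ^ 2 + 1) := by
    rw [sub_nonneg, div_le_one (by positivity)]
    nlinarith [sq_nonneg b]
  have h1 : 1 - ε / (8 * b ^ 2 + 1) ≤ Real.exp (-(ε / (8 * b ^ 2 + 1))) := by
    linarith [Real.add_one_le_exp (-(ε / (8 * b ^ 2 + 1)))]
  refine (pow_le_pow_left₀ hq h1 _).trans ?_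
  rw [← Real.exp_nat_mul]
  conv_rhs => rw [← Real.exp_log hδ.1]
  refine Real.exp_le_exp.mpr ?_
  have h2 := Nat.le_ceil ((8 * b ^ 2 + 1) / ε * Real.log (1 / δ))
  have h3 := mul_le_mul_of_nonneg_right h2 hq0.le
  have h4 : (8 * b ^ 2 + 1) / ε * Real.log (1 / δ) * (ε / (8 * b ^ 2 + 1)) = Real.log (1 / δ) := by
    field_simp
  rw [h4, one_div, Real.log_inv] at h3
  rw [spotCheckCount, one_div, Real.log_inv]
  linarith

theorem spotCheckCount_le {b ε δ : ℝ} (hε : ε ∈ Set.Ioo (0 : ℝ) 1) (hδ : δ ∈ Set.Ioo (0 : ℝ) 1) :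
    (spotCheckCount b ε δ : ℝ)
      ≤ (8 * b ^ 2 + 1) * (1 / ε ^ 2) * (1 + Real.log (1 / δ)) := by
  obtain ⟨hε0, hε1⟩ := hε
  have hl : 0 ≤ Real.log (1 / δ) := Real.log_nonneg (by rw [le_div_iff₀ hδ.1]; linarith [hδ.2])
  have h0 : 0 ≤ (8 * b ^ 2 + 1) / ε * Real.log (1 / δ) := by positivity
  have h1 : 1 / ε ≤ 1 / ε ^ 2 := one_div_le_one_div_of_le (by positivity) (by nlinarith)
  have h2 : 1 ≤ 1 / ε ^ 2 := by
    rw [le_div_iff₀ (by positivity)]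
    nlinarith
  refine (Nat.ceil_lt_add_one h0).le.trans ?_
  have h3 : (8 * b ^ 2 + 1) / ε * Real.log (1 / δ)
      ≤ (8 * b ^ 2 + 1) * (1 / ε ^ 2) * Real.log (1 / δ) := by
    rw [div_eq_mul_one_div]
    gcongr
  -- This absorbs the `+ 1` from the ceiling into the summand `1` of `1 + log (1 / δ)`.
  have h4 : 1 ≤ (8 * b ^ 2 + 1) * (1 / ε ^ 2) := by nlinarith [sq_nonneg b]
  linarith

theorem mainTheorem3 :
    ∃ d : ℕ, ∀ b : ℝ, 0 ≤ b → ∃ (C : ℝ) (κ : ℕ → ℝ → ℝ → ℕ),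
      (∀ (Z : ℕ) (ε δ : ℝ), 1 ≤ Z → ε ∈ Set.Ioo (0 : ℝ) 1 → δ ∈ Set.Ioo (0 : ℝ) 1 →
        (κ Z ε δ : ℝ) ≤
          C * (1 / ε ^ 2) * (1 + Real.log (Z : ℝ)) ^ d * (1 + Real.log (1 / δ)) ^ d) ∧
      ∀ (N Z : ℕ) (p ε δ : ℝ), 1 ≤ Z → p ∈ Set.Ioo (0 : ℝ) 1 →
        ε ∈ Set.Ioo (0 : ℝ) 1 → δ ∈ Set.Ioo (0 : ℝ) 1 →
        ∃ S : InteractiveProofSystem N Z,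
          S.IsPACVerifier b p ε δ (κ Z ε δ) ∧ S.ExchangesMessages 2 := by
  -- The count ignores `Z`; the factor `1 + log Z ≥ 1` in the bound is pure slack.
  refine ⟨1, fun b hb => ⟨8 * b ^ 2 + 1, fun _ => spotCheckCount b, ?_, ?_⟩⟩
  · intro Z ε δ hZ hε hδ
    have hlZ : 0 ≤ Real.log (Z : ℝ) := Real.log_nonneg (by exact_mod_cast hZ)
    have hlδ : 0 ≤ Real.log (1 / δ) := Real.log_nonneg (by rw [le_div_iff₀ hδ.1]; linarith [hδ.2])
    refine (spotCheckCount_le hε hδ).trans ?_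
    rw [pow_one, pow_one]
    refine mul_le_mul_of_nonneg_right ?_ (by linarith)
    exact le_mul_of_one_le_right (by positivity) (by linarith)
  · intro N Z p ε δ _ hp hε hδ
    refine ⟨tableProofSystem N Z b p ε hp.1.le hp.2.le (spotCheckCount b ε δ),
      ⟨fun f hf => ?_, fun f hf P => ?_, fun f _ P => ?_⟩, fun f P o ho => ?_⟩
    · rw [tableProofSystem_complete hp.1.le hp.2.le _ hε.1 f hf]
      exact ENNReal.ofReal_le_one.mpr (by linarith [hδ.1])
    · exact (tableProofSystem_sound hp.1.le hp.2.le _ hb hε f hf P).trans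
        (ENNReal.ofReal_le_ofReal (pow_spotCheckCount_le hε hδ))
    · exact tableProofSystem_expectedTrainings_le hp.1.le hp.2.le _ f P
    · exact (tableProofSystem_support hp.1.le hp.2.le _ f P o ho).2
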